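/- For each $i\in\mathbb N$ consider a normal linear regression model $$\boldsymbol Y_i=\boldsymbol X_i\boldsymbol\beta_i+\boldsymbol\varepsilon_i,\qquad \boldsymbol\varepsilon_i\sim N_{n_i}(\boldsymbol 0,\sigma^2\boldsymbol I_{n_i}),$$ where $\sigma>0$ does not depend on $i$, and $\boldsymbol X_i$ is a real $n_i\times(2+k_i)$ matrix of full column rank whose first column consists of ones and whose second column (the grouping variable) has entries in $\{0,1\}$. The coefficient vector is $\boldsymbol\beta_i=(\beta_0,\beta_1,\dots,\beta_{1+k_i})'$; its entry $\beta_1$, the coefficient of the grouping variable, is the same for all $i$ (the number $k_i\ge 0$ of additional explanatory variables and the other coefficients may be constant or vary with $i$). Put $$d=\frac{\beta_1}{\sigma},\qquad m_i=n_i-2-k_i,$$ $$\widehat{\boldsymbol\beta}_i=(\boldsymbol X_i'\boldsymbol X_i)^{-1}\boldsymbol X_i'\boldsymbol Y_i,\qquad \widehat\sigma_i^2=m_i^{-1}(\boldsymbol Y_i-\boldsymbol X_i\widehat{\boldsymbol\beta}_i)'(\boldsymbol Y_i-\boldsymbol X_i\widehat{\boldsymbol\beta}_i),\qquad \widehat d_i=\frac{\widehat\beta_{1,i}}{\sqrt{\widehat\sigma_i^2}},$$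 where $\widehat\beta_{1,i}$ is the entry of $\widehat{\boldsymbol\beta}_i$ that estimates $\beta_1$. Suppose that $m_i\to\infty$ as $i\to\infty$. Then: 1. $\widehat d_i$ is integrable for all sufficiently large $i$, and $\lim_{i\to\infty}\mathrm E(\widehat d_i)=d$; that is, $\widehat d$ is asymptotically unbiased for $d$. 2. $\widehat d_i$ is square integrable for all sufficiently large $i$. If $\lim_{i\to\infty}\mathrm{var}(\widehat\beta_{1,i})=0$, then $\lim_{i\to\infty}\mathrm{var}(\widehat d_i)=0$ and $\lim_{i\to\infty}\mathrm E\big[(\widehat d_i-d)^2\big]=0$; that is, $\widehat d$ is consistent in quadratic mean for $d$. -/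

import Mathlib

open MeasureTheory ProbabilityTheory Filter Topology
open scoped Matrix

noncomputable section

namespace CohenD

/-- Admissible model matrices of the linear regression
`Y = β₀ + β₁ X₁ + β₂ X₂ + ⋯ + β₍₁₊ₖ₎ X₍₁₊ₖ₎ + ε` with `n` observations: column `0` is the intercept,
column `1` is the 0/1 grouping variable, columns `2, …, k + 1` are the `k` further explanatory
variables, and the matrix has full column rank. -/
structure IsModelMatrix {n k : ℕ} (X : Matrix (Fin n) (Fin (k + 2)) ℝ) : Prop where
  intercept : ∀ i, X i 0 = 1
  group : ∀ i, X i 1 = 0 ∨ X i 1 = 1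
  full_rank : X.rank = k + 2

/-- The response vector `Y = X β + ε`. -/
def response {n k : ℕ} (X : Matrix (Fin n) (Fin (k + 2)) ℝ) (β : Fin (k + 2) → ℝ)
    (ε : EuclideanSpace ℝ (Fin n)) : Fin n → ℝ :=
  fun i => (X *ᵥ β) i + ε i

/-- The error assumption of the normal linear regression model on `(Ω, P)`:
`ε` is `n`-variate normal with expectation `0` and covariance matrix `σ² Iₙ`, where `σ² > 0`. -/
structure IsNormalError {n : ℕ} {Ω : Type*} [MeasurableSpace Ω] (P : Measure Ω) (σ : ℝ)
    (ε : Ω → EuclideanSpace ℝ (Fin n)) : Prop where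
  sigma_pos : 0 < σ
  law : HasLaw ε (multivariateGaussian 0 (σ ^ 2 • (1 : Matrix (Fin n) (Fin n) ℝ))) P

/-- Residual degrees of freedom `m = n - 2 - k`, as a real number (no truncation). -/
def dof (n k : ℕ) : ℝ := (n : ℝ) - 2 - k

/-- The least squares estimator `(Xᵀ X)⁻¹ Xᵀ y`. -/
def betaHat {n k : ℕ} (X : Matrix (Fin n) (Fin (k + 2)) ℝ) (y : Fin n → ℝ) : Fin (k + 2) → ℝ :=
  (Xᵀ * X)⁻¹ *ᵥ (Xᵀ *ᵥ y)

/-- The least squares estimator of the coefficient `β₁` of the grouping variable. -/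
def betaHatOne {n k : ℕ} (X : Matrix (Fin n) (Fin (k + 2)) ℝ) (y : Fin n → ℝ) : ℝ :=
  betaHat X y 1

/-- The usual unbiased variance estimator `m⁻¹ (y - X β̂)ᵀ (y - X β̂)`. -/
def sigmaSqHat {n k : ℕ} (X : Matrix (Fin n) (Fin (k + 2)) ℝ) (y : Fin n → ℝ) : ℝ :=
  (dof n k)⁻¹ * ((y - X *ᵥ betaHat X y) ⬝ᵥ (y - X *ᵥ betaHat X y))

/-- The generalized Cohen estimator `d̂ = β̂₁ / √σ̂²`. -/
def dHat {n k : ℕ} (X : Matrix (Fin n) (Fin (k + 2)) ℝ) (y : Fin n → ℝ) : ℝ :=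
  betaHatOne X y / √(sigmaSqHat X y)

/-- Consistency in quadratic mean of a sequence of estimators `T i`, each on its own probability
space, for `θ`: the mean squared error is eventually finite and tends to `0`. -/
def ConsistentInQuadraticMean {Ω : ℕ → Type*} [∀ i, MeasurableSpace (Ω i)]
    (P : ∀ i, Measure (Ω i)) (T : ∀ i, Ω i → ℝ) (θ : ℝ) : Prop :=
  (∀ᶠ i in atTop, MemLp (fun ω => T i ω - θ) 2 (P i)) ∧
    Tendsto (fun i => ∫ ω, (T i ω - θ) ^ 2 ∂(P i)) atTop (𝓝 0)

end CohenD

end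

/-! The estimator is a quotient of independent variables. The noise in `β̂₁` is the inner product of
`ε` with a vector orthogonal to the residual space, while `σ̂²` depends only on the coordinates of
`ε` in an orthonormal basis of that space, so `σ̂² = (σ² / m) Q` with `Q` a sum of `m` independent
squared standard normals. Independence gives `E d̂ = β₁ E[1/σ̂]` and, for `m > 2`, `E d̂² = (var β̂₁
+ β₁²) E[1/σ̂²]`.

The exact value of `E[1/σ̂]` involves Gamma functions and is not needed. Jensen bounds it below by
`1/σ`, since `E σ̂² = σ²`, and Cauchy–Schwarz bounds it above by `√E[1/σ̂²]`. As `E[1/Q] = 1/(m -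
2)`, the upper bound is `√(m/(m - 2)) / σ`, and both bounds tend to `1/σ`. If also `var β̂₁ → 0`,
then `E d̂² → d²`, and the variance and the mean squared error follow by expanding squares.

The main ingredients are `lintegral_inv_sum_sq`, `inv_sqrt_integral_le`,
`exists_sigmaSqHat_eq_sum_sq` and `indepFun_betaHatOne_sigmaSqHat`. -/

theorem integral_exp_neg_mul_sq_gaussianReal {t : ℝ} (ht : 0 < t) :
    ∫ x, Real.exp (-t * x ^ 2) ∂(gaussianReal 0 1) = (1 + 2 * t) ^ (-(1 / 2) : ℝ) := by
  rw [integral_gaussianReal_eq_integral_smul one_ne_zero]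
  have h (x : ℝ) : gaussianPDFReal 0 1 x • Real.exp (-t * x ^ 2) =
      (√(2 * Real.pi))⁻¹ * Real.exp (-(t + 1 / 2) * x ^ 2) := by
    rw [gaussianPDFReal, smul_eq_mul, mul_assoc, ← Real.exp_add]
    simp only [NNReal.coe_one, mul_one, sub_zero]
    congr 2
    ring
  simp_rw [h]
  rw [integral_const_mul, integral_gaussian, ← Real.sqrt_inv, ← Real.sqrt_mul (by positivity),
    Real.rpow_neg (by positivity), ← Real.sqrt_eq_rpow, ← Real.sqrt_inv]
  congr 1
  have := Real.pi_pos.ne'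
  have : t + 1 / 2 ≠ 0 := by positivity
  have : 1 + 2 * t ≠ 0 := by positivity
  field_simp
  ring

theorem lintegral_exp_neg_mul_Ioi {q : ℝ} (hq : 0 < q) :
    ∫⁻ t in Set.Ioi (0 : ℝ), ENNReal.ofReal (Real.exp (-t * q)) = ENNReal.ofReal q⁻¹ := by
  have hI : IntegrableOn (fun t : ℝ => Real.exp (-q * t)) (Set.Ioi 0) :=
    integrableOn_exp_mul_Ioi (by linarith) 0
  have h := integral_exp_mul_Ioi (a := -q) (by linarith) 0
  have e (t : ℝ) : -t * q = -q * t := by ring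
  simp_rw [e]
  rw [← ofReal_integral_eq_lintegral_ofReal hI (ae_of_all _ fun t => (Real.exp_pos _).le), h]
  simp

theorem lintegral_one_add_two_mul_rpow_Ioi {m : ℝ} (hm : 2 < m) :
    ∫⁻ t in Set.Ioi (0 : ℝ), ENNReal.ofReal ((1 + 2 * t) ^ (-(m / 2))) =
      ENNReal.ofReal (m - 2)⁻¹ := by
  have hm' : m - 2 ≠ 0 := by linarith
  -- Explicit antiderivative; `2 < m` makes its exponent `1 - m / 2` negative, so it vanishes at
  -- infinity.
  have hd : ∀ t ∈ Set.Ici (0 : ℝ), HasDerivAt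
      (fun t : ℝ => -(m - 2)⁻¹ * (1 + 2 * t) ^ (1 - m / 2)) ((1 + 2 * t) ^ (-(m / 2))) t := by
    intro t ht
    have ht : (0 : ℝ) ≤ t := ht
    have h1 : HasDerivAt (fun t : ℝ => 1 + 2 * t) 2 t := by
      simpa using ((hasDerivAt_id t).const_mul 2).const_add 1
    have h2 := (h1.rpow_const (p := 1 - m / 2) (Or.inl (by positivity))).const_mul (-(m - 2)⁻¹)
    rw [show 1 - m / 2 - 1 = -(m / 2) by ring] at h2
    refine h2.congr_deriv ?_
    field_simp
    ring
  have hnn : ∀ t ∈ Set.Ioi (0 : ℝ), 0 ≤ (1 + 2 * t) ^ (-(m / 2)) := fun t ht =>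
    Real.rpow_nonneg (by have : (0 : ℝ) < t := ht; positivity) _
  have hlim : Tendsto (fun t : ℝ => -(m - 2)⁻¹ * (1 + 2 * t) ^ (1 - m / 2)) atTop (𝓝 0) := by
    have h1 : Tendsto (fun t : ℝ => 1 + 2 * t) atTop atTop :=
      tendsto_atTop_add_const_left _ _ (tendsto_id.const_mul_atTop two_pos)
    have h2 := (tendsto_rpow_neg_atTop (y := m / 2 - 1) (by linarith)).comp h1
    simpa [Function.comp_def] using h2.const_mul (-(m - 2)⁻¹)
  have hI := integrableOn_Ioi_deriv_of_nonneg' hd hnn hlim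
  rw [← ofReal_integral_eq_lintegral_ofReal hI ((ae_restrict_iff' measurableSet_Ioi).2
    (ae_of_all _ hnn)), integral_Ioi_of_hasDerivAt_of_nonneg' hd hnn hlim]
  simp

/-! ### Moments of a sum of squared independent standard normals -/

section ChiSquare

variable {Ω : Type*} [MeasurableSpace Ω] {P : Measure Ω}
  {m : ℕ} {Z : Fin m → Ω → ℝ}

theorem integral_exp_neg_mul_sum_sq (hZ : ∀ j, HasLaw (Z j) (gaussianReal 0 1) P)
    (hind : iIndepFun Z P) {t : ℝ} (ht : 0 < t) :
    ∫ ω, Real.exp (-t * ∑ j, Z j ω ^ 2) ∂P = (1 + 2 * t) ^ (-((m : ℝ) / 2)) := by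
  simp_rw [Finset.mul_sum, Real.exp_sum]
  rw [hind.integral_fun_prod_comp (f := fun _ x => Real.exp (-t * x ^ 2))
    (fun j => (hZ j).aemeasurable) (fun j => by fun_prop)]
  have h (j : Fin m) : ∫ ω, Real.exp (-t * Z j ω ^ 2) ∂P = (1 + 2 * t) ^ (-(1 / 2) : ℝ) := by
    rw [← integral_exp_neg_mul_sq_gaussianReal ht]
    exact (hZ j).integral_comp (f := fun x => Real.exp (-t * x ^ 2)) (by fun_prop)
  simp_rw [h]
  rw [Finset.prod_const, Finset.card_univ, Fintype.card_fin, ← Real.rpow_mul_natCast (by positivity)]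
  congr 1
  ring

theorem ae_sum_sq_pos (hZ : ∀ j, HasLaw (Z j) (gaussianReal 0 1) P) (hm : 0 < m) :
    ∀ᵐ ω ∂P, 0 < ∑ j, Z j ω ^ 2 := by
  have : NullSingletonClass (gaussianReal 0 1) := nullSingletonClass_gaussianReal one_ne_zero
  -- One nonzero coordinate suffices, and a nondegenerate Gaussian has no atoms.
  have h : ∀ᵐ ω ∂P, Z ⟨0, hm⟩ ω ≠ 0 := by
    rw [(hZ _).ae_iff (p := fun x => x ≠ 0) (by fun_prop)]
    simp [ae_iff]
  filter_upwards [h] with ω hω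
  exact Finset.sum_pos' (fun _ _ => sq_nonneg _) ⟨⟨0, hm⟩, Finset.mem_univ _, by positivity⟩

/-- Write `1/Q` as the integral of `exp (-t Q)` over `t > 0`, swap by Tonelli, and integrate the
Laplace transform `(1 + 2t)^(-m/2)`. With `lintegral` no prior integrability is required; finiteness
of the value then yields it. -/
theorem lintegral_inv_sum_sq [IsProbabilityMeasure P]
    (hZ : ∀ j, HasLaw (Z j) (gaussianReal 0 1) P)
    (hind : iIndepFun Z P) (hm : 2 < m) :
    ∫⁻ ω, ENNReal.ofReal (∑ j, Z j ω ^ 2)⁻¹ ∂P = ENNReal.ofReal ((m : ℝ) - 2)⁻¹ := by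
  have hmeas (j : Fin m) : AEMeasurable (Z j) P := (hZ j).aemeasurable
  have hQ : AEMeasurable (fun ω => ∑ j, Z j ω ^ 2) P := by fun_prop
  have hm' : (2 : ℝ) < m := by exact_mod_cast hm
  rw [← lintegral_one_add_two_mul_rpow_Ioi hm']
  calc ∫⁻ ω, ENNReal.ofReal (∑ j, Z j ω ^ 2)⁻¹ ∂P
      = ∫⁻ ω, (∫⁻ t in Set.Ioi (0 : ℝ),
          ENNReal.ofReal (Real.exp (-t * ∑ j, Z j ω ^ 2))) ∂P := by
        refine lintegral_congr_ae ?_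
        filter_upwards [ae_sum_sq_pos hZ (by omega)] with ω hω
        exact (lintegral_exp_neg_mul_Ioi hω).symm
    _ = ∫⁻ t in Set.Ioi (0 : ℝ), (∫⁻ ω,
          ENNReal.ofReal (Real.exp (-t * ∑ j, Z j ω ^ 2)) ∂P) := by
        refine lintegral_lintegral_swap ?_
        have h1 : AEMeasurable (fun p : Ω × ℝ => ∑ j, Z j p.1 ^ 2)
            (P.prod (volume.restrict (Set.Ioi 0))) := hQ.comp_fst
        have h2 : AEMeasurable (fun p : Ω × ℝ => p.2)
            (P.prod (volume.restrict (Set.Ioi 0))) := measurable_snd.aemeasurable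
        exact (Real.measurable_exp.comp_aemeasurable (h2.neg.mul h1)).ennreal_ofReal
    _ = _ := by
        refine setLIntegral_congr_fun measurableSet_Ioi fun t ht => ?_
        have ht : 0 < t := ht
        have hb : Integrable (fun ω => Real.exp (-t * ∑ j, Z j ω ^ 2)) P := by
          refine Integrable.of_bound (C := 1) (by fun_prop) (ae_of_all _ fun ω => ?_)
          rw [Real.norm_eq_abs, abs_of_pos (Real.exp_pos _), Real.exp_le_one_iff]
          have : 0 ≤ ∑ j, Z j ω ^ 2 := Finset.sum_nonneg fun _ _ => sq_nonneg _
          nlinarith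
        rw [← ofReal_integral_eq_lintegral_ofReal hb (ae_of_all _ fun ω => (Real.exp_pos _).le),
          integral_exp_neg_mul_sum_sq hZ hind ht]

theorem integrable_inv_sum_sq [IsProbabilityMeasure P]
    (hZ : ∀ j, HasLaw (Z j) (gaussianReal 0 1) P)
    (hind : iIndepFun Z P) (hm : 2 < m) : Integrable (fun ω => (∑ j, Z j ω ^ 2)⁻¹) P := by
  have hmeas (j : Fin m) : AEMeasurable (Z j) P := (hZ j).aemeasurable
  have hQ : AEMeasurable (fun ω => (∑ j, Z j ω ^ 2)⁻¹) P := by fun_prop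
  refine (lintegral_ofReal_ne_top_iff_integrable hQ.aestronglyMeasurable
    (ae_of_all _ fun ω => inv_nonneg.2 (Finset.sum_nonneg fun _ _ => sq_nonneg _))).1 ?_
  rw [lintegral_inv_sum_sq hZ hind hm]
  exact ENNReal.ofReal_ne_top

theorem integral_inv_sum_sq [IsProbabilityMeasure P]
    (hZ : ∀ j, HasLaw (Z j) (gaussianReal 0 1) P)
    (hind : iIndepFun Z P) (hm : 2 < m) : ∫ ω, (∑ j, Z j ω ^ 2)⁻¹ ∂P = ((m : ℝ) - 2)⁻¹ := by
  have hm' : (2 : ℝ) < m := by exact_mod_cast hm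
  rw [integral_eq_lintegral_of_nonneg_ae
    (ae_of_all _ fun ω => inv_nonneg.2 (Finset.sum_nonneg fun _ _ => sq_nonneg _))
    (integrable_inv_sum_sq hZ hind hm).aestronglyMeasurable, lintegral_inv_sum_sq hZ hind hm,
    ENNReal.toReal_ofReal (inv_nonneg.2 (by linarith))]

theorem integrable_sq_of_hasLaw_gaussianReal {W : Ω → ℝ} (hW : HasLaw W (gaussianReal 0 1) P) :
    Integrable (fun ω => W ω ^ 2) P := by
  have h := memLp_id_gaussianReal' (μ := 0) (v := 1) 2 (by norm_num)
  rw [← hW.map_eq] at h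
  exact (h.comp_of_map hW.aemeasurable).integrable_sq

theorem integral_sum_sq (hZ : ∀ j, HasLaw (Z j) (gaussianReal 0 1) P) :
    ∫ ω, ∑ j, Z j ω ^ 2 ∂P = m := by
  rw [integral_finsetSum _ fun j _ => integrable_sq_of_hasLaw_gaussianReal (hZ j)]
  have h (j : Fin m) : ∫ ω, Z j ω ^ 2 ∂P = 1 := by
    have h1 : Var[Z j; P] = 1 := by
      rw [(hZ j).variance_eq, variance_id_gaussianReal]; simp
    have h2 : ∫ ω, Z j ω ∂P = 0 := by
      rw [(hZ j).integral_eq, integral_id_gaussianReal]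
    rw [← h1, variance_eq_integral (hZ j).aemeasurable, h2]
    simp
  simp [h]

end ChiSquare

/-! ### Quotients by the root of an independent positive variable -/

section Ratio

variable {Ω : Type*} [MeasurableSpace Ω] {P : Measure Ω} {Y S : Ω → ℝ}

/-- For `c > 0` the left side is the tangent to the convex function `x ↦ x^(-1/2)` at `x = c⁻²`.
With `u = √x` the gap is `(1 - cu)² (2 + cu) / (2u)`. -/
theorem inv_sqrt_tangent_le {c x : ℝ} (hc : 0 ≤ c) (hx : 0 < x) :
    3 / 2 * c - 1 / 2 * c ^ 3 * x ≤ (√x)⁻¹ := by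
  obtain ⟨u, hu, rfl⟩ : ∃ u, 0 < u ∧ x = u ^ 2 :=
    ⟨√x, Real.sqrt_pos.2 hx, (Real.sq_sqrt hx.le).symm⟩
  rw [Real.sqrt_sq hu.le, ← one_div, le_div_iff₀ hu]
  nlinarith [mul_nonneg (sq_nonneg (1 - c * u)) (by positivity : 0 ≤ 2 + c * u)]

theorem memLp_inv_sqrt (hS : Integrable (fun ω => (S ω)⁻¹) P) (hpos : ∀ᵐ ω ∂P, 0 < S ω) :
    MemLp (fun ω => (√(S ω))⁻¹) 2 P := by
  have hm : AEMeasurable (fun ω => (√(S ω))⁻¹) P := by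
    simpa [Real.sqrt_inv] using hS.aemeasurable.sqrt
  refine (memLp_two_iff_integrable_sq hm.aestronglyMeasurable).2 (hS.congr ?_)
  filter_upwards [hpos] with ω hω
  rw [inv_pow, Real.sq_sqrt hω.le]

theorem integral_inv_sqrt_sq (hpos : ∀ᵐ ω ∂P, 0 < S ω) :
    ∫ ω, (√(S ω))⁻¹ ^ 2 ∂P = ∫ ω, (S ω)⁻¹ ∂P := by
  refine integral_congr_ae ?_
  filter_upwards [hpos] with ω hω
  rw [inv_pow, Real.sq_sqrt hω.le]

/-- This is nonnegativity of the variance of `S^(-1/2)`. -/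
theorem integral_inv_sqrt_sq_le [IsProbabilityMeasure P]
    (hS : Integrable (fun ω => (S ω)⁻¹) P) (hpos : ∀ᵐ ω ∂P, 0 < S ω) :
    (∫ ω, (√(S ω))⁻¹ ∂P) ^ 2 ≤ ∫ ω, (S ω)⁻¹ ∂P := by
  have h := variance_nonneg (fun ω => (√(S ω))⁻¹) P
  rw [variance_eq_sub (memLp_inv_sqrt hS hpos)] at h
  simp only [Pi.pow_apply] at h
  rw [integral_inv_sqrt_sq hpos] at h
  linarith

/-- Jensen's inequality for `x ↦ x^(-1/2)`, obtained by integrating the tangent line at the mean of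
`S`. -/
theorem inv_sqrt_integral_le [IsProbabilityMeasure P] (hS : Integrable S P)
    (hSi : Integrable (fun ω => (S ω)⁻¹) P) (hpos : ∀ᵐ ω ∂P, 0 < S ω)
    (hs : 0 < ∫ ω, S ω ∂P) : (√(∫ ω, S ω ∂P))⁻¹ ≤ ∫ ω, (√(S ω))⁻¹ ∂P := by
  set s := ∫ ω, S ω ∂P with hs_def
  set c := (√s)⁻¹ with hc
  have hc0 : 0 < c := inv_pos.2 (Real.sqrt_pos.2 hs)
  have hcs : c ^ 3 * s = c := by
    have h : c ^ 2 * s = 1 := by rw [hc, inv_pow, Real.sq_sqrt hs.le, inv_mul_cancel₀ hs.ne']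
    linear_combination c * h
  calc c = ∫ ω, (3 / 2 * c - 1 / 2 * c ^ 3 * S ω) ∂P := by
        rw [integral_sub (integrable_const _) (hS.const_mul _), integral_const,
          integral_const_mul, ← hs_def]
        simp only [probReal_univ, one_smul]
        linear_combination (1 / 2 : ℝ) * hcs
    _ ≤ _ := by
        refine integral_mono_ae ((integrable_const _).sub (hS.const_mul _))
          ((memLp_inv_sqrt hSi hpos).integrable (by norm_num)) ?_
        filter_upwards [hpos] with ω hω
        exact inv_sqrt_tangent_le hc0.le hω

theorem ProbabilityTheory.IndepFun.memLp_div_sqrt (hYS : IndepFun Y S P) (hY : MemLp Y 2 P)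
    (hSm : AEMeasurable S P)
    (hS : Integrable (fun ω => (S ω)⁻¹) P) (hpos : ∀ᵐ ω ∂P, 0 < S ω) :
    MemLp (fun ω => Y ω / √(S ω)) 2 P := by
  have hm : AEMeasurable (fun ω => Y ω / √(S ω)) P := hY.aemeasurable.div hSm.sqrt
  refine (memLp_two_iff_integrable_sq hm.aestronglyMeasurable).2 ?_
  have h : IndepFun (fun ω => Y ω ^ 2) (fun ω => (S ω)⁻¹) P :=
    hYS.comp (φ := fun y => y ^ 2) (ψ := fun s => s⁻¹) (by fun_prop) (by fun_prop)
  refine (h.integrable_mul hY.integrable_sq hS).congr ?_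
  filter_upwards [hpos] with ω hω
  rw [Pi.mul_apply, div_pow, Real.sq_sqrt hω.le, div_eq_mul_inv]

theorem ProbabilityTheory.IndepFun.integral_div_sqrt (hYS : IndepFun Y S P)
    (hY : AEMeasurable Y P) (hS : AEMeasurable S P) :
    ∫ ω, Y ω / √(S ω) ∂P = (∫ ω, Y ω ∂P) * ∫ ω, (√(S ω))⁻¹ ∂P := by
  simp_rw [div_eq_mul_inv]
  exact hYS.integral_fun_comp_mul_comp (f := fun y => y) (g := fun s => (√s)⁻¹) hY hS
    (by fun_prop) (Measurable.aestronglyMeasurable (by fun_prop))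

theorem ProbabilityTheory.IndepFun.integral_div_sqrt_sq (hYS : IndepFun Y S P)
    (hY : AEMeasurable Y P) (hS : AEMeasurable S P) (hpos : ∀ᵐ ω ∂P, 0 < S ω) :
    ∫ ω, (Y ω / √(S ω)) ^ 2 ∂P = (∫ ω, Y ω ^ 2 ∂P) * ∫ ω, (S ω)⁻¹ ∂P := by
  rw [← hYS.integral_fun_comp_mul_comp (f := fun y => y ^ 2) (g := fun s => s⁻¹) hY hS
    (by fun_prop) (Measurable.aestronglyMeasurable (by fun_prop))]
  refine integral_congr_ae ?_
  filter_upwards [hpos] with ω hω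
  rw [div_pow, Real.sq_sqrt hω.le, div_eq_mul_inv]

end Ratio

namespace CohenD

/-! ### Linear algebra of least squares -/

section Regression

variable {n k : ℕ} {X : Matrix (Fin n) (Fin (k + 2)) ℝ}

theorem IsModelMatrix.isUnit_det (hX : IsModelMatrix X) : IsUnit (Xᵀ * X).det := by
  rw [← Matrix.isUnit_iff_isUnit_det]
  refine (Matrix.linearIndependent_cols_iff_isUnit (A := Xᵀ * X)).1 ?_
  rw [linearIndependent_iff_card_eq_finrank_span, Set.finrank, ← Matrix.rank_eq_finrank_span_cols,
    Matrix.rank_transpose_mul_self, hX.full_rank, Fintype.card_fin]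

theorem betaHat_response (hX : IsModelMatrix X) (β : Fin (k + 2) → ℝ)
    (e : EuclideanSpace ℝ (Fin n)) :
    betaHat X (response X β e) = β + betaHat X e.ofLp := by
  have h : response X β e = X *ᵥ β + e.ofLp := rfl
  rw [h, betaHat, betaHat, Matrix.mulVec_add, Matrix.mulVec_add, Matrix.mulVec_mulVec,
    Matrix.mulVec_mulVec, Matrix.mul_assoc, Matrix.nonsing_inv_mul _ hX.isUnit_det,
    Matrix.one_mulVec]

theorem residual_response (hX : IsModelMatrix X) (β : Fin (k + 2) → ℝ)
    (e : EuclideanSpace ℝ (Fin n)) :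
    response X β e - X *ᵥ betaHat X (response X β e) = e.ofLp - X *ᵥ betaHat X e.ofLp := by
  have h : response X β e = X *ᵥ β + e.ofLp := rfl
  rw [betaHat_response hX, h, Matrix.mulVec_add]
  abel

theorem transpose_mulVec_residual (hX : IsModelMatrix X) (y : Fin n → ℝ) :
    Xᵀ *ᵥ (y - X *ᵥ betaHat X y) = 0 := by
  rw [betaHat, Matrix.mulVec_sub, Matrix.mulVec_mulVec, Matrix.mulVec_mulVec,
    Matrix.mul_nonsing_inv _ hX.isUnit_det, Matrix.one_mulVec, sub_self]

/-- The residual space of the model: the orthogonal complement of the column space of `X`. -/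
def residualSpace (X : Matrix (Fin n) (Fin (k + 2)) ℝ) :
    Submodule ℝ (EuclideanSpace ℝ (Fin n)) :=
  LinearMap.ker (Xᵀ.mulVecLin ∘ₗ (WithLp.linearEquiv 2 ℝ (Fin n → ℝ)).toLinearMap)

theorem mem_residualSpace {w : EuclideanSpace ℝ (Fin n)} :
    w ∈ residualSpace X ↔ Xᵀ *ᵥ w.ofLp = 0 :=
  Iff.rfl

theorem finrank_residualSpace (hX : IsModelMatrix X) :
    (Module.finrank ℝ (residualSpace X) : ℝ) = dof n k := by
  have h := LinearMap.finrank_range_add_finrank_ker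
    (Xᵀ.mulVecLin ∘ₗ (WithLp.linearEquiv 2 ℝ (Fin n → ℝ)).toLinearMap)
  rw [LinearMap.range_comp_of_range_eq_top _ (LinearEquiv.range _), finrank_euclideanSpace_fin]
    at h
  change Xᵀ.rank + Module.finrank ℝ (residualSpace X) = n at h
  rw [Matrix.rank_transpose, hX.full_rank] at h
  have h' : (k : ℝ) + 2 + Module.finrank ℝ (residualSpace X) = n := by exact_mod_cast h
  rw [dof]
  linarith

theorem inner_toLp_mulVec_of_mem_residualSpace {w : EuclideanSpace ℝ (Fin n)}
    (hw : w ∈ residualSpace X) (v : Fin (k + 2) → ℝ) :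
    inner ℝ w (WithLp.toLp 2 (X *ᵥ v)) = 0 := by
  rw [EuclideanSpace.inner_eq_star_dotProduct, star_trivial, dotProduct_comm,
    Matrix.dotProduct_mulVec, ← Matrix.mulVec_transpose, mem_residualSpace.1 hw, zero_dotProduct]

/-- The residual is the orthogonal projection of `e` onto the residual space: apply Parseval there,
and drop the fitted part, which is orthogonal to every basis vector. -/
theorem residual_dotProduct_self (hX : IsModelMatrix X) (e : EuclideanSpace ℝ (Fin n)) :
    (e.ofLp - X *ᵥ betaHat X e.ofLp) ⬝ᵥ (e.ofLp - X *ᵥ betaHat X e.ofLp) =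
      ∑ j, inner ℝ (stdOrthonormalBasis ℝ (residualSpace X) j : EuclideanSpace ℝ (Fin n)) e ^ 2 := by
  set r : EuclideanSpace ℝ (Fin n) := e - WithLp.toLp 2 (X *ᵥ betaHat X e.ofLp) with hr
  have hmem : r ∈ residualSpace X := mem_residualSpace.2 (transpose_mulVec_residual hX e.ofLp)
  have h1 : (e.ofLp - X *ᵥ betaHat X e.ofLp) ⬝ᵥ (e.ofLp - X *ᵥ betaHat X e.ofLp) = ‖r‖ ^ 2 := by
    rw [← real_inner_self_eq_norm_sq, EuclideanSpace.inner_eq_star_dotProduct, star_trivial]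
    rfl
  have h2 := (stdOrthonormalBasis ℝ (residualSpace X)).sum_sq_norm_inner_right ⟨r, hmem⟩
  rw [h1, show ‖r‖ = ‖(⟨r, hmem⟩ : residualSpace X)‖ from rfl, ← h2]
  refine Finset.sum_congr rfl fun j _ => ?_
  rw [Real.norm_eq_abs, sq_abs, Submodule.coe_inner]
  change inner ℝ _ (e - WithLp.toLp 2 (X *ᵥ betaHat X e.ofLp)) ^ 2 = _
  rw [ inner_sub_right,
    inner_toLp_mulVec_of_mem_residualSpace (Submodule.coe_mem _), sub_zero]

/-- The vector of coefficients of the linear functional `β̂₁`. -/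
noncomputable def betaHatOneVec (X : Matrix (Fin n) (Fin (k + 2)) ℝ) : EuclideanSpace ℝ (Fin n) :=
  WithLp.toLp 2 (((Xᵀ * X)⁻¹ * Xᵀ) 1)

theorem inner_betaHatOneVec (e : EuclideanSpace ℝ (Fin n)) :
    inner ℝ (betaHatOneVec X) e = betaHatOne X e.ofLp := by
  rw [EuclideanSpace.inner_eq_star_dotProduct, star_trivial, dotProduct_comm, betaHatOne, betaHat,
    Matrix.mulVec_mulVec]
  rfl

/-- `β̂₁` sees the data only through `Xᵀ y`, which vanishes on the residual space. This
orthogonality is the source of the independence of `β̂₁` and `σ̂²`. -/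
theorem inner_betaHatOneVec_of_mem_residualSpace {w : EuclideanSpace ℝ (Fin n)}
    (hw : w ∈ residualSpace X) : inner ℝ (betaHatOneVec X) w = 0 := by
  rw [inner_betaHatOneVec, betaHatOne, betaHat, mem_residualSpace.1 hw, Matrix.mulVec_zero]
  rfl

theorem betaHatOne_response (hX : IsModelMatrix X) (β : Fin (k + 2) → ℝ)
    (e : EuclideanSpace ℝ (Fin n)) :
    betaHatOne X (response X β e) = β 1 + inner ℝ (betaHatOneVec X) e := by
  rw [inner_betaHatOneVec, betaHatOne, betaHat_response hX]
  rfl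

theorem sigmaSqHat_response (hX : IsModelMatrix X) (β : Fin (k + 2) → ℝ)
    (e : EuclideanSpace ℝ (Fin n)) :
    sigmaSqHat X (response X β e) = (dof n k)⁻¹ *
      ∑ j, inner ℝ (stdOrthonormalBasis ℝ (residualSpace X) j : EuclideanSpace ℝ (Fin n)) e ^ 2 := by
  rw [sigmaSqHat, residual_response hX, residual_dotProduct_self hX]

end Regression

/-! ### Linear functionals of the normal error -/

section Errors

variable {n : ℕ} {Ω : Type*} [MeasurableSpace Ω] {P : Measure Ω} {σ : ℝ}
  {ε : Ω → EuclideanSpace ℝ (Fin n)}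

theorem IsNormalError.hasGaussianLaw (hε : IsNormalError P σ ε) : HasGaussianLaw ε P :=
  hε.law.hasGaussianLaw

theorem IsNormalError.covariance_inner (hε : IsNormalError P σ ε)
    (x y : EuclideanSpace ℝ (Fin n)) :
    cov[fun ω => inner ℝ x (ε ω), fun ω => inner ℝ y (ε ω); P] = σ ^ 2 * inner ℝ x y := by
  have hS : (σ ^ 2 • (1 : Matrix (Fin n) (Fin n) ℝ)).PosSemidef :=
    Matrix.PosSemidef.one.smul (sq_nonneg σ)
  rw [hε.law.covariance_fun_comp (f := fun u => inner ℝ x u) (g := fun u => inner ℝ y u)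
    (by fun_prop) (by fun_prop),
    ← covarianceBilin_apply_eq_cov (IsGaussian.memLp_two_id), covarianceBilin_multivariateGaussian hS,
    Matrix.smul_mulVec, Matrix.one_mulVec, dotProduct_smul, smul_eq_mul,
    EuclideanSpace.inner_eq_star_dotProduct, star_trivial, dotProduct_comm]

theorem IsNormalError.integral_inner (hε : IsNormalError P σ ε)
    (x : EuclideanSpace ℝ (Fin n)) : ∫ ω, inner ℝ x (ε ω) ∂P = 0 := by
  rw [_root_.integral_inner hε.hasGaussianLaw.integrable, hε.law.integral_eq,
    integral_id_multivariateGaussian, inner_zero_right]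

theorem IsNormalError.hasLaw_inner [IsProbabilityMeasure P] (hε : IsNormalError P σ ε)
    {x : EuclideanSpace ℝ (Fin n)} (hx : ‖x‖ = 1) :
    HasLaw (fun ω => σ⁻¹ * inner ℝ x (ε ω)) (gaussianReal 0 1) P := by
  have hg : HasGaussianLaw (fun ω => inner ℝ (σ⁻¹ • x) (ε ω)) P :=
    hε.hasGaussianLaw.map_fun (innerSL ℝ (σ⁻¹ • x))
  have hσ := hε.sigma_pos.ne'
  have hv : Var[fun ω => inner ℝ (σ⁻¹ • x) (ε ω); P] = 1 := by
    rw [← covariance_self hg.aemeasurable, hε.covariance_inner, real_inner_self_eq_norm_sq,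
      norm_smul, hx, mul_one, Real.norm_eq_abs, sq_abs]
    field_simp
  have h := hg.map_eq_gaussianReal
  rw [hε.integral_inner, hv, Real.toNNReal_one] at h
  simp_rw [inner_smul_left] at h hg
  exact ⟨hg.aemeasurable, h⟩

theorem IsNormalError.iIndepFun_inner {m : ℕ} {b : Fin m → EuclideanSpace ℝ (Fin n)}
    (hε : IsNormalError P σ ε) (hb : Orthonormal ℝ b) :
    iIndepFun (fun j ω => σ⁻¹ * inner ℝ (b j) (ε ω)) P := by
  have hg : HasGaussianLaw (fun ω j => σ⁻¹ * inner ℝ (b j) (ε ω)) P :=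
    hε.hasGaussianLaw.map_fun
      (ContinuousLinearMap.pi fun j => σ⁻¹ • innerSL ℝ (b j))
  refine hg.iIndepFun_of_covariance_eq_zero fun i j hij => ?_
  rw [covariance_const_mul_left, covariance_const_mul_right, hε.covariance_inner, hb.2 hij]
  simp

/-- The functionals are jointly Gaussian, so vanishing covariances already give independence. -/
theorem IsNormalError.indepFun_inner {m : ℕ} {a : EuclideanSpace ℝ (Fin n)}
    {b : Fin m → EuclideanSpace ℝ (Fin n)}
    (hε : IsNormalError P σ ε) (hab : ∀ j, inner ℝ a (b j) = 0) :
    IndepFun (fun ω => inner ℝ a (ε ω)) (fun ω j => inner ℝ (b j) (ε ω)) P := by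
  -- The criterion compares two families, so the single functional is viewed as a family over
  -- `Unit`.
  have hg : HasGaussianLaw (fun ω => (fun _ : Unit => inner ℝ a (ε ω),
      fun j => inner ℝ (b j) (ε ω))) P :=
    hε.hasGaussianLaw.map_fun
      ((ContinuousLinearMap.pi fun _ : Unit => innerSL ℝ a).prod
        (ContinuousLinearMap.pi fun j => innerSL ℝ (b j)))
  have h := hg.indepFun_of_covariance_eval (X := fun _ : Unit => fun ω => inner ℝ a (ε ω))
    (Y := fun j ω => inner ℝ (b j) (ε ω)) fun _ j => by
      rw [hε.covariance_inner, hab, mul_zero]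
  have hφ : Measurable fun f : Unit → ℝ => f () := measurable_pi_apply ()
  exact h.comp hφ measurable_id

end Errors

/-! ### Laws and moments of the estimators -/

section Estimators

variable {n k : ℕ} {X : Matrix (Fin n) (Fin (k + 2)) ℝ} {Ω : Type*} [MeasurableSpace Ω]
  {P : Measure Ω} {σ : ℝ} {ε : Ω → EuclideanSpace ℝ (Fin n)}

theorem hasGaussianLaw_inner_betaHatOneVec (hε : IsNormalError P σ ε) :
    HasGaussianLaw (fun ω => inner ℝ (betaHatOneVec X) (ε ω)) P :=
  hε.hasGaussianLaw.map_fun (innerSL ℝ (betaHatOneVec X))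

theorem memLp_betaHatOne [IsProbabilityMeasure P] (hX : IsModelMatrix X)
    (hε : IsNormalError P σ ε) (β : Fin (k + 2) → ℝ) :
    MemLp (fun ω => betaHatOne X (response X β (ε ω))) 2 P := by
  simp_rw [betaHatOne_response hX]
  exact (memLp_const (β 1)).add (hasGaussianLaw_inner_betaHatOneVec hε).memLp_two

theorem integral_betaHatOne [IsProbabilityMeasure P] (hX : IsModelMatrix X)
    (hε : IsNormalError P σ ε) (β : Fin (k + 2) → ℝ) :
    ∫ ω, betaHatOne X (response X β (ε ω)) ∂P = β 1 := by
  simp_rw [betaHatOne_response hX]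
  rw [integral_add (integrable_const _) (hasGaussianLaw_inner_betaHatOneVec hε).integrable,
    hε.integral_inner]
  simp

theorem indepFun_betaHatOne_sigmaSqHat (hX : IsModelMatrix X)
    (hε : IsNormalError P σ ε) (β : Fin (k + 2) → ℝ) :
    IndepFun (fun ω => betaHatOne X (response X β (ε ω)))
      (fun ω => sigmaSqHat X (response X β (ε ω))) P := by
  simp_rw [betaHatOne_response hX, sigmaSqHat_response hX]
  have h := hε.indepFun_inner (a := betaHatOneVec X)
    (b := fun j => (stdOrthonormalBasis ℝ (residualSpace X) j : EuclideanSpace ℝ (Fin n)))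
    fun j => inner_betaHatOneVec_of_mem_residualSpace (Submodule.coe_mem _)
  have hφ : Measurable fun y : ℝ => β 1 + y := by fun_prop
  have hψ : Measurable fun z : Fin (Module.finrank ℝ (residualSpace X)) → ℝ =>
      (dof n k)⁻¹ * ∑ j, z j ^ 2 := by fun_prop
  exact h.comp hφ hψ

/-- The `Z j` are the coordinates of `ε / σ` in an orthonormal basis of the residual space, whose
dimension is the residual degrees of freedom. -/
theorem exists_sigmaSqHat_eq_sum_sq [IsProbabilityMeasure P] (hX : IsModelMatrix X)
    (hε : IsNormalError P σ ε) (β : Fin (k + 2) → ℝ) :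
    ∃ (m : ℕ) (Z : Fin m → Ω → ℝ), (m : ℝ) = dof n k ∧
      (∀ j, HasLaw (Z j) (gaussianReal 0 1) P) ∧ iIndepFun Z P ∧
      ∀ ω, sigmaSqHat X (response X β (ε ω)) = σ ^ 2 / dof n k * ∑ j, Z j ω ^ 2 := by
  have hb : Orthonormal ℝ fun j =>
      (stdOrthonormalBasis ℝ (residualSpace X) j : EuclideanSpace ℝ (Fin n)) :=
    (stdOrthonormalBasis ℝ (residualSpace X)).orthonormal.comp_linearIsometry
      (residualSpace X).subtypeₗᵢ
  refine ⟨_, fun j ω => σ⁻¹ * inner ℝ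
    (stdOrthonormalBasis ℝ (residualSpace X) j : EuclideanSpace ℝ (Fin n)) (ε ω),
    finrank_residualSpace hX, fun j => hε.hasLaw_inner (hb.1 j), hε.iIndepFun_inner hb,
    fun ω => ?_⟩
  have hσ := hε.sigma_pos.ne'
  simp_rw [sigmaSqHat_response hX, mul_pow]
  rw [← Finset.mul_sum, ← mul_assoc]
  congr 1
  field_simp

theorem ae_sigmaSqHat_pos [IsProbabilityMeasure P] (hX : IsModelMatrix X)
    (hε : IsNormalError P σ ε) (β : Fin (k + 2) → ℝ) (hm : 0 < dof n k) :
    ∀ᵐ ω ∂P, 0 < sigmaSqHat X (response X β (ε ω)) := by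
  obtain ⟨m, Z, hmd, hZ, -, hS⟩ := exists_sigmaSqHat_eq_sum_sq hX hε β
  have hm' : 0 < m := by rw [← hmd] at hm; exact_mod_cast hm
  filter_upwards [ae_sum_sq_pos hZ hm'] with ω hω
  rw [hS]
  have := hε.sigma_pos
  positivity

theorem integrable_sigmaSqHat [IsProbabilityMeasure P] (hX : IsModelMatrix X)
    (hε : IsNormalError P σ ε) (β : Fin (k + 2) → ℝ) :
    Integrable (fun ω => sigmaSqHat X (response X β (ε ω))) P := by
  obtain ⟨m, Z, -, hZ, -, hS⟩ := exists_sigmaSqHat_eq_sum_sq hX hε β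
  simp_rw [hS]
  exact (integrable_finsetSum _ fun j _ =>
    integrable_sq_of_hasLaw_gaussianReal (hZ j)).const_mul _

theorem integral_sigmaSqHat [IsProbabilityMeasure P] (hX : IsModelMatrix X)
    (hε : IsNormalError P σ ε) (β : Fin (k + 2) → ℝ) (hm : 0 < dof n k) :
    ∫ ω, sigmaSqHat X (response X β (ε ω)) ∂P = σ ^ 2 := by
  obtain ⟨m, Z, hmd, hZ, -, hS⟩ := exists_sigmaSqHat_eq_sum_sq hX hε β
  simp_rw [hS]
  rw [integral_const_mul, integral_sum_sq hZ, hmd, div_mul_cancel₀ _ hm.ne']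

theorem integrable_inv_sigmaSqHat [IsProbabilityMeasure P] (hX : IsModelMatrix X)
    (hε : IsNormalError P σ ε) (β : Fin (k + 2) → ℝ) (hm : 2 < dof n k) :
    Integrable (fun ω => (sigmaSqHat X (response X β (ε ω)))⁻¹) P := by
  obtain ⟨m, Z, hmd, hZ, hind, hS⟩ := exists_sigmaSqHat_eq_sum_sq hX hε β
  have hm' : 2 < m := by rw [← hmd] at hm; exact_mod_cast hm
  simp_rw [hS, mul_inv]
  exact (integrable_inv_sum_sq hZ hind hm').const_mul _

theorem integral_inv_sigmaSqHat [IsProbabilityMeasure P] (hX : IsModelMatrix X)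
    (hε : IsNormalError P σ ε) (β : Fin (k + 2) → ℝ) (hm : 2 < dof n k) :
    ∫ ω, (sigmaSqHat X (response X β (ε ω)))⁻¹ ∂P =
      (σ ^ 2 / dof n k)⁻¹ * (dof n k - 2)⁻¹ := by
  obtain ⟨m, Z, hmd, hZ, hind, hS⟩ := exists_sigmaSqHat_eq_sum_sq hX hε β
  have hm' : 2 < m := by rw [← hmd] at hm; exact_mod_cast hm
  simp_rw [hS, mul_inv (σ ^ 2 / dof n k)]
  rw [integral_const_mul, integral_inv_sum_sq hZ hind hm', hmd]

theorem memLp_dHat [IsProbabilityMeasure P] (hX : IsModelMatrix X)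
    (hε : IsNormalError P σ ε) (β : Fin (k + 2) → ℝ) (hm : 2 < dof n k) :
    MemLp (fun ω => dHat X (response X β (ε ω))) 2 P :=
  (indepFun_betaHatOne_sigmaSqHat hX hε β).memLp_div_sqrt (memLp_betaHatOne hX hε β)
    (integrable_sigmaSqHat hX hε β).aemeasurable (integrable_inv_sigmaSqHat hX hε β hm)
    (ae_sigmaSqHat_pos hX hε β (by linarith))

/-- No lower bound on `dof` is needed: the product formula for Bochner integrals of independent
variables requires only measurability. -/
theorem integral_dHat [IsProbabilityMeasure P] (hX : IsModelMatrix X)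
    (hε : IsNormalError P σ ε) (β : Fin (k + 2) → ℝ) :
    ∫ ω, dHat X (response X β (ε ω)) ∂P =
      β 1 * ∫ ω, (√(sigmaSqHat X (response X β (ε ω))))⁻¹ ∂P := by
  rw [← integral_betaHatOne hX hε β]
  exact (indepFun_betaHatOne_sigmaSqHat hX hε β).integral_div_sqrt
    (memLp_betaHatOne hX hε β).aemeasurable (integrable_sigmaSqHat hX hε β).aemeasurable

theorem integral_dHat_sq [IsProbabilityMeasure P] (hX : IsModelMatrix X)
    (hε : IsNormalError P σ ε) (β : Fin (k + 2) → ℝ) (hm : 2 < dof n k) :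
    ∫ ω, dHat X (response X β (ε ω)) ^ 2 ∂P =
      (Var[fun ω => betaHatOne X (response X β (ε ω)); P] + β 1 ^ 2) *
        ((σ ^ 2 / dof n k)⁻¹ * (dof n k - 2)⁻¹) := by
  have hv := variance_eq_sub (memLp_betaHatOne hX hε β)
  rw [integral_betaHatOne hX hε β] at hv
  simp only [Pi.pow_apply] at hv
  rw [hv, sub_add_cancel, ← integral_inv_sigmaSqHat hX hε β hm]
  exact (indepFun_betaHatOne_sigmaSqHat hX hε β).integral_div_sqrt_sq
    (memLp_betaHatOne hX hε β).aemeasurable (integrable_sigmaSqHat hX hε β).aemeasurable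
    (ae_sigmaSqHat_pos hX hε β (by linarith))

theorem inv_sigma_le_integral_inv_sqrt_sigmaSqHat [IsProbabilityMeasure P] (hX : IsModelMatrix X)
    (hε : IsNormalError P σ ε) (β : Fin (k + 2) → ℝ) (hm : 2 < dof n k) :
    σ⁻¹ ≤ ∫ ω, (√(sigmaSqHat X (response X β (ε ω))))⁻¹ ∂P := by
  have h := inv_sqrt_integral_le (integrable_sigmaSqHat hX hε β)
    (integrable_inv_sigmaSqHat hX hε β hm) (ae_sigmaSqHat_pos hX hε β (by linarith))
  rw [integral_sigmaSqHat hX hε β (by linarith), Real.sqrt_sq hε.sigma_pos.le] at h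
  exact h (pow_pos hε.sigma_pos 2)

theorem integral_inv_sqrt_sigmaSqHat_le [IsProbabilityMeasure P] (hX : IsModelMatrix X)
    (hε : IsNormalError P σ ε) (β : Fin (k + 2) → ℝ) (hm : 2 < dof n k) :
    ∫ ω, (√(sigmaSqHat X (response X β (ε ω))))⁻¹ ∂P ≤
      √((σ ^ 2 / dof n k)⁻¹ * (dof n k - 2)⁻¹) := by
  rw [← integral_inv_sigmaSqHat hX hε β hm]
  exact Real.le_sqrt_of_sq_le (integral_inv_sqrt_sq_le (integrable_inv_sigmaSqHat hX hε β hm)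
    (ae_sigmaSqHat_pos hX hε β (by linarith)))

end Estimators

/-- Rests on `d / (d - 2) = 1 + 2 / (d - 2)`. -/
theorem tendsto_inv_div_mul_inv_sub_two {ι : Type*} {l : Filter ι} {d : ι → ℝ} (s : ℝ)
    (hd : Tendsto d l atTop) :
    Tendsto (fun i => (s / d i)⁻¹ * (d i - 2)⁻¹) l (𝓝 s⁻¹) := by
  have h2 : Tendsto (fun i => d i - 2) l atTop := tendsto_atTop_add_const_right _ (-2) hd
  have h : Tendsto (fun i => s⁻¹ * (1 + 2 * (d i - 2)⁻¹)) l (𝓝 (s⁻¹ * (1 + 2 * 0))) :=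
    ((h2.inv_tendsto_atTop.const_mul 2).const_add 1).const_mul _
  rw [mul_zero, add_zero, mul_one] at h
  refine h.congr' ?_
  filter_upwards [h2.eventually_gt_atTop 0] with i hi
  rw [inv_div, div_eq_mul_inv]
  field_simp
  ring

end CohenD

open CohenD in
theorem mainTheorem5
    {Ω : ℕ → Type*} [∀ i, MeasurableSpace (Ω i)]
    (P : ∀ i, Measure (Ω i)) [∀ i, IsProbabilityMeasure (P i)]
    (n k : ℕ → ℕ)
    (X : ∀ i, Matrix (Fin (n i)) (Fin (k i + 2)) ℝ)
    (β : ∀ i, Fin (k i + 2) → ℝ) (β₁ σ : ℝ)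
    (ε : ∀ i, Ω i → EuclideanSpace ℝ (Fin (n i)))
    (hX : ∀ i, CohenD.IsModelMatrix (X i))
    (hβ : ∀ i, β i 1 = β₁)
    (hε : ∀ i, CohenD.IsNormalError (P i) σ (ε i))
    (hm : Tendsto (fun i => CohenD.dof (n i) (k i)) atTop atTop) :
    ((∀ᶠ i in atTop,
        Integrable (fun ω => CohenD.dHat (X i) (CohenD.response (X i) (β i) (ε i ω))) (P i)) ∧
      Tendsto
        (fun i => ∫ ω, CohenD.dHat (X i) (CohenD.response (X i) (β i) (ε i ω)) ∂(P i))
        atTop (𝓝 (β₁ / σ))) ∧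
    (∀ᶠ i in atTop,
        MemLp (fun ω => CohenD.dHat (X i) (CohenD.response (X i) (β i) (ε i ω))) 2 (P i)) ∧
    (Tendsto
        (fun i => variance
          (fun ω => CohenD.betaHatOne (X i) (CohenD.response (X i) (β i) (ε i ω))) (P i))
        atTop (𝓝 0) →
      Tendsto
        (fun i => variance
          (fun ω => CohenD.dHat (X i) (CohenD.response (X i) (β i) (ε i ω))) (P i))
        atTop (𝓝 0) ∧
      CohenD.ConsistentInQuadraticMean P
        (fun i ω => CohenD.dHat (X i) (CohenD.response (X i) (β i) (ε i ω))) (β₁ / σ)) := by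
  have hev : ∀ᶠ i in atTop, 2 < dof (n i) (k i) := hm.eventually_gt_atTop 2
  have hσ : 0 < σ := (hε 0).sigma_pos
  have hL2 : ∀ᶠ i in atTop,
      MemLp (fun ω => dHat (X i) (response (X i) (β i) (ε i ω))) 2 (P i) :=
    hev.mono fun i hi => memLp_dHat (hX i) (hε i) (β i) hi
  have hc := tendsto_inv_div_mul_inv_sub_two (σ ^ 2) hm
  have hr : Tendsto
      (fun i => ∫ ω, (√(sigmaSqHat (X i) (response (X i) (β i) (ε i ω))))⁻¹ ∂(P i))
      atTop (𝓝 σ⁻¹) := by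
    have hsq := hc.sqrt
    rw [Real.sqrt_inv, Real.sqrt_sq hσ.le] at hsq
    -- Squeeze between the Jensen bound and the second-moment bound.
    exact tendsto_of_tendsto_of_tendsto_of_le_of_le' tendsto_const_nhds hsq
      (hev.mono fun i hi => inv_sigma_le_integral_inv_sqrt_sigmaSqHat (hX i) (hε i) (β i) hi)
      (hev.mono fun i hi => integral_inv_sqrt_sigmaSqHat_le (hX i) (hε i) (β i) hi)
  have hE : Tendsto (fun i => ∫ ω, dHat (X i) (response (X i) (β i) (ε i ω)) ∂(P i))
      atTop (𝓝 (β₁ / σ)) := by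
    simp_rw [integral_dHat (hX _) (hε _), hβ]
    exact hr.const_mul β₁
  refine ⟨⟨hL2.mono fun i hi => hi.integrable (by norm_num), hE⟩, hL2, fun hv => ?_⟩
  have hE2 : Tendsto (fun i => ∫ ω, dHat (X i) (response (X i) (β i) (ε i ω)) ^ 2 ∂(P i))
      atTop (𝓝 ((β₁ / σ) ^ 2)) := by
    have h := (hv.add_const (β₁ ^ 2)).mul hc
    rw [zero_add, ← div_eq_mul_inv, ← div_pow] at h
    refine h.congr' (hev.mono fun i hi => ?_)
    beta_reduce
    rw [integral_dHat_sq (hX i) (hε i) (β i) hi, hβ]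
  refine ⟨?_, hL2.mono fun i hi => hi.sub (memLp_const _), ?_⟩
  · have h := hE2.sub (hE.pow 2)
    rw [sub_self] at h
    refine h.congr' (hL2.mono fun i hi => ?_)
    beta_reduce
    rw [variance_eq_sub hi]
    rfl
  -- The mean squared error is `E d̂² - 2 d E d̂ + d²`, whose limit is `d² - 2d² + d² = 0`.
  · have h := (hE2.sub (hE.const_mul (2 * (β₁ / σ)))).add_const ((β₁ / σ) ^ 2)
    rw [show (β₁ / σ) ^ 2 - 2 * (β₁ / σ) * (β₁ / σ) + (β₁ / σ) ^ 2 = 0 by ring] at h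
    refine h.congr' (hL2.mono fun i hi => ?_)
    have hI := hi.integrable (q := 2) (by norm_num)
    have e (ω : Ω i) : (dHat (X i) (response (X i) (β i) (ε i ω)) - β₁ / σ) ^ 2 =
        dHat (X i) (response (X i) (β i) (ε i ω)) ^ 2 -
          2 * (β₁ / σ) * dHat (X i) (response (X i) (β i) (ε i ω)) + (β₁ / σ) ^ 2 := by ring
    have hI2 : Integrable (fun ω => dHat (X i) (response (X i) (β i) (ε i ω)) ^ 2 -
        2 * (β₁ / σ) * dHat (X i) (response (X i) (β i) (ε i ω))) (P i) :=
      hi.integrable_sq.sub (hI.const_mul _)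
    simp_rw [e]
    rw [integral_add hI2 (integrable_const _),
      integral_sub hi.integrable_sq (hI.const_mul _), integral_const_mul, integral_const]
    simp
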